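/- Let $k$ be a field that is complete with respect to a non-trivial non-Archimedean absolute value. A Banach $k$-vector space is a complete normed $k$-vector space whose norm satisfies the ultrametric inequality $\|x+y\|\le\max\{\|x\|,\|y\|\}$; isomorphisms of Banach $k$-vector spaces are isometric $k$-linear bijections. For a family $(W_i)_{i\in I}$ of Banach $k$-vector spaces, the bounded direct product is the space of all families $(w_i)_{i\in I}$, $w_i\in W_i$, with $\sup_i\|w_i\|<\infty$, equipped with the supremum norm, and the completed direct sum is its closed subspace of those families for which $\{i\in I : \|w_i\|\ge\varepsilon\}$ is finite for every $\varepsilon>0$. For a constant family $(V)_{i\in I}$ these are denoted by $\ell^\infty(I,V)$ and $C_0(I,V)$. Let $\kappa$ be an infinite cardinal or the class of all ordinals. Let $\mathscr R$ (the non-Archimedean Reid class with respect to $\kappa$) be the smallest class of Banach $k$-vector spaces that contains $k$ and is closed under isomorphism and under bounded direct products and completed direct sums over index sets $I$ of cardinality less than $\kappa$ (arbitrary index sets if $\kappa$ is the class of all ordinals). A Banach $k$-vector space $V$ is called reflexive if the canonical map $V\to V^{\vee\vee}$ into its double dual is an isometric bijection. The field $k$ is called spherically complete if every decreasing sequence of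 closed balls of positive radius in $k$ has non-empty intersection. Corollary. Suppose that $\kappa\neq\omega$ and that $k$ is not spherically complete. Then $\mathscr R$ is not closed under taking quotients by closed subspaces. More precisely, $\ell^\infty(\omega,k)$ belongs to $\mathscr R$, and its quotient $\ell^\infty(\omega,k)/C_0(\omega,k)$ by the closed subspace $C_0(\omega,k)$, with the quotient norm, is not reflexive and does not belong to $\mathscr R$. -/

import Mathlib

open scoped ENNReal Cardinal

universe u

/-- A metric space is spherically complete if every decreasing sequence of closed balls of
positive radius has a common point. -/
def IsSphericallyComplete (X : Type*) [PseudoMetricSpace X] : Prop :=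
  ∀ (a : ℕ → X) (r : ℕ → ℝ), (∀ n, 0 < r n) →
    (∀ n, Metric.closedBall (a (n + 1)) (r (n + 1)) ⊆ Metric.closedBall (a n) (r n)) →
      (⋂ n, Metric.closedBall (a n) (r n)).Nonempty

/-- The class of (non-Archimedean) Banach `k`-vector spaces. -/
structure Ban (k : Type u) [NontriviallyNormedField k] : Type (u + 1) where
  carrier : Type u
  [normedAddCommGroup : NormedAddCommGroup carrier]
  [normedSpace : NormedSpace k carrier]
  [completeSpace : CompleteSpace carrier]
  [isUltrametricDist : IsUltrametricDist carrier]

namespace Ban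

attribute [instance] Ban.normedAddCommGroup Ban.normedSpace Ban.completeSpace
  Ban.isUltrametricDist

instance (k : Type u) [NontriviallyNormedField k] : CoeSort (Ban k) (Type u) := ⟨Ban.carrier⟩

/-- Isomorphism of Banach spaces: an isometric linear bijection exists. -/
def Iso {k : Type u} [NontriviallyNormedField k] (V W : Ban k) : Prop :=
  Nonempty (V ≃ₗᵢ[k] W)

/-- The ground field as a Banach space over itself. -/
def ground (k : Type u) [NontriviallyNormedField k] [CompleteSpace k] [IsUltrametricDist k] :
    Ban k where
  carrier := k

theorem isUltrametricDist_lp {k : Type u} [NontriviallyNormedField k] {I : Type u}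
    (W : I → Ban k) : IsUltrametricDist (lp (fun i => (W i : Type u)) ∞) := by
  refine IsUltrametricDist.isUltrametricDist_of_forall_norm_add_le_max_norm fun x y => ?_
  refine lp.norm_le_of_forall_le (le_max_of_le_left (norm_nonneg x)) fun i => ?_
  calc ‖(x + y) i‖ = ‖x i + y i‖ := rfl
    _ ≤ max ‖x i‖ ‖y i‖ := IsUltrametricDist.norm_add_le_max _ _
    _ ≤ max ‖x‖ ‖y‖ := max_le_max (lp.norm_apply_le_norm ENNReal.top_ne_zero x i)
        (lp.norm_apply_le_norm ENNReal.top_ne_zero y i)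

/-- The bounded direct product of a family of Banach spaces: bounded families with the supremum
norm. -/
noncomputable def boundedProd {k : Type u} [NontriviallyNormedField k] {I : Type u} (W : I → Ban k) :
    Ban k where
  carrier := lp (fun i => (W i : Type u)) ∞
  isUltrametricDist := isUltrametricDist_lp W

/-- The subspace of the bounded direct product of the families tending to `0`, i.e. such that for
any `ε > 0` only finitely many entries have norm at least `ε`. -/
noncomputable def nullFamilies {k : Type u} [NontriviallyNormedField k] {I : Type u}
    (W : I → Ban k) : Submodule k (boundedProd W) :=
  let N : Submodule k (lp (fun i => (W i : Type u)) ∞) :=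
    { carrier := {w | ∀ ε : ℝ, 0 < ε → {i | ε ≤ ‖w i‖}.Finite}
      zero_mem' := by
        intro ε hε
        refine Set.finite_empty.subset fun i hi => ?_
        have h : ε ≤ ‖(0 : W i)‖ := hi
        rw [norm_zero] at h
        exact absurd h (not_le.2 hε)
      add_mem' := by
        intro x y hx hy ε hε
        refine ((hx ε hε).union (hy ε hε)).subset fun i hi => ?_
        have h : ε ≤ max ‖x i‖ ‖y i‖ :=
          le_trans (show ε ≤ ‖x i + y i‖ from hi) (IsUltrametricDist.norm_add_le_max _ _)
        exact le_max_iff.1 h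
      smul_mem' := by
        intro c x hx ε hε
        rcases eq_or_ne c 0 with rfl | hc
        · refine Set.finite_empty.subset fun i hi => ?_
          have h : ε ≤ ‖(0 : k) • x i‖ := hi
          rw [zero_smul, norm_zero] at h
          exact absurd h (not_le.2 hε)
        · have hc' : 0 < ‖c‖ := norm_pos_iff.2 hc
          refine (hx (ε / ‖c‖) (div_pos hε hc')).subset fun i hi => ?_
          have h : ε ≤ ‖c • x i‖ := hi
          rw [norm_smul] at h
          exact (div_le_iff₀' hc').2 h }
  N

theorem isClosed_nullFamilies {k : Type u} [NontriviallyNormedField k] {I : Type u}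
    (W : I → Ban k) : IsClosed (nullFamilies W : Set (boundedProd W)) := by
  refine isClosed_of_closure_subset fun x hx ε hε => ?_
  obtain ⟨y, hy, hxy⟩ := Metric.mem_closure_iff.1 hx ε hε
  refine (hy ε hε).subset fun i hi => ?_
  have hd : ‖x - y‖ < ε := by rwa [dist_eq_norm] at hxy
  have hi1 : ‖x.1 i - y.1 i‖ < ε :=
    lt_of_le_of_lt (lp.norm_apply_le_norm (E := fun i => (W i : Type u)) ENNReal.top_ne_zero
      (x - y) i) hd
  have hi2 : ε ≤ ‖x.1 i‖ := hi
  have h := IsUltrametricDist.norm_add_le_max (x.1 i - y.1 i) (y.1 i)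
  rw [sub_add_cancel] at h
  rcases le_max_iff.1 (hi2.trans h) with h' | h'
  · exact absurd h' (not_le.2 hi1)
  · exact h'

/-- A closed subspace of a Banach space. -/
noncomputable def ofClosed {k : Type u} [NontriviallyNormedField k] (V : Ban k) (S : Submodule k V)
    (hS : IsClosed (S : Set V)) : Ban k where
  carrier := S
  completeSpace := hS.completeSpace_coe
  isUltrametricDist := IsUltrametricDist.subtype _

/-- The completed direct sum of a family of Banach spaces: families tending to `0`, with the
supremum norm. -/
noncomputable def completedSum {k : Type u} [NontriviallyNormedField k] {I : Type u} (W : I → Ban k) : Ban k :=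
  (boundedProd W).ofClosed (nullFamilies W) (isClosed_nullFamilies W)

theorem isUltrametricDist_quotient {k : Type u} [NontriviallyNormedField k] (V : Ban k)
    (S : Submodule k V) : IsUltrametricDist (V ⧸ S) := by
  refine IsUltrametricDist.isUltrametricDist_of_forall_norm_add_le_max_norm fun x y => ?_
  refine le_of_forall_pos_lt_add fun ε hε => ?_
  obtain ⟨a, rfl, ha⟩ := QuotientAddGroup.exists_norm_mk_lt (S := S.toAddSubgroup) x hε
  obtain ⟨b, rfl, hb⟩ := QuotientAddGroup.exists_norm_mk_lt (S := S.toAddSubgroup) y hε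
  calc _ ≤ ‖a + b‖ := Submodule.Quotient.norm_mk_le S (a + b)
    _ ≤ max ‖a‖ ‖b‖ := IsUltrametricDist.norm_add_le_max _ _
    _ < _ := by
      rw [← max_add_add_right]
      exact max_lt_max ha hb

/-- The quotient of a Banach space by a closed subspace, with the quotient norm. -/
noncomputable def quotient {k : Type u} [NontriviallyNormedField k] (V : Ban k)
    (S : Submodule k V) (hS : IsClosed (S : Set V)) : Ban k where
  carrier := V ⧸ S
  normedAddCommGroup := Submodule.Quotient.normedAddCommGroup S (hS := hS)
  normedSpace := Submodule.Quotient.normedSpace S k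
  completeSpace := Submodule.Quotient.completeSpace S
  isUltrametricDist := isUltrametricDist_quotient V S

/-- A Banach space is reflexive if the canonical map into its double dual is an isomorphism of
Banach spaces, i.e. an isometric bijection. -/
def IsReflexive {k : Type u} [NontriviallyNormedField k] (V : Ban k) : Prop :=
  Isometry (NormedSpace.inclusionInDoubleDual k V) ∧
    Function.Surjective (NormedSpace.inclusionInDoubleDual k V)

/-- The non-Archimedean Reid class with respect to `κ`: the smallest class of Banach
`k`-vector spaces that contains `k`, is closed under isomorphism, and is closed under bounded
direct products and completed direct sums over index sets of cardinality less than `κ`. Here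
`κ = ⊤` stands for the class of all ordinals: no bound on the index sets. -/
inductive Reid (k : Type u) [NontriviallyNormedField k] [CompleteSpace k] [IsUltrametricDist k]
    (κ : WithTop Cardinal.{u}) : Ban k → Prop
  | ground : Reid k κ (ground k)
  | iso (V W : Ban k) (e : V.Iso W) (hV : Reid k κ V) : Reid k κ W
  | boundedProd (I : Type u) (hI : ((#I : Cardinal.{u}) : WithTop Cardinal.{u}) < κ)
      (W : I → Ban k) (hW : ∀ i, Reid k κ (W i)) : Reid k κ (boundedProd W)
  | completedSum (I : Type u) (hI : ((#I : Cardinal.{u}) : WithTop Cardinal.{u}) < κ)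
      (W : I → Ban k) (hW : ∀ i, Reid k κ (W i)) : Reid k κ (completedSum W)

/-- A class of Banach spaces is closed under taking quotients by closed subspaces. -/
def ClosedUnderQuotients {k : Type u} [NontriviallyNormedField k] (C : Ban k → Prop) : Prop :=
  ∀ V : Ban k, C V → ∀ (S : Submodule k V) (hS : IsClosed (S : Set V)), C (V.quotient S hS)

/-- `ℓ^∞(I, V)`. -/
noncomputable def ellInfty {k : Type u} [NontriviallyNormedField k] (I : Type u) (V : Ban k) : Ban k :=
  boundedProd fun _ : I => V

/-- `C₀(I, V)`, as a subspace of `ℓ^∞(I, V)`. -/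
noncomputable def cZero {k : Type u} [NontriviallyNormedField k] (I : Type u) (V : Ban k) :
    Submodule k (ellInfty I V) :=
  nullFamilies fun _ : I => V

theorem isClosed_cZero {k : Type u} [NontriviallyNormedField k] (I : Type u) (V : Ban k) :
    IsClosed (cZero I V : Set (ellInfty I V)) :=
  isClosed_nullFamilies fun _ : I => V

end Ban

/-! The obstruction is point separation by the dual. It holds for `k` and passes to bounded products
and to subspaces, hence to the whole Reid class, and it holds for reflexive spaces. The quotient
`ℓ^∞/C₀` violates it, because its dual is zero. Indeed, let `f ≠ 0` on `ℓ^∞` vanish on `C₀`, and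
take nested balls in `k` with empty intersection. Lift their centres through `f` to vectors `x n`
that are equally tightly nested, up to the factor `‖f‖`. The diagonal of the `x n` is, modulo `C₀`,
within `r n / ‖f‖` of every `x n`, so its image under `f` lies in all the balls, a contradiction. -/

/-- A space that is not spherically complete has a nested sequence of balls without common point
whose radii decrease strictly. -/
theorem exists_strictAnti_radii_of_not_isSphericallyComplete {X : Type*} [PseudoMetricSpace X]
    [IsUltrametricDist X] (h : ¬ IsSphericallyComplete X) :
    ∃ (a : ℕ → X) (r : ℕ → ℝ), (∀ n, 0 < r n) ∧ StrictAnti r ∧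
      (∀ n, dist (a (n + 1)) (a n) ≤ r n) ∧ ∀ x, ∃ n, r n < dist x (a n) := by
  unfold IsSphericallyComplete at h
  push Not at h
  obtain ⟨a, r, hr, hsub, hempty⟩ := h
  have hanti : Antitone fun n => Metric.closedBall (a n) (r n) := antitone_nat_of_succ_le hsub
  have hmem (n m : ℕ) (hnm : n ≤ m) : dist (a m) (a n) ≤ r n :=
    hanti hnm (Metric.mem_closedBall_self (hr m).le)
  -- Otherwise some radius `r j` is minimal among all radii, and its centre `a j` lies in every
  -- ball.
  have hescape (N : ℕ) : ∃ n, N < n ∧ ∀ j ≤ N, r n < r j := by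
    by_contra! hN
    obtain ⟨j, hjN, hj⟩ := Finset.exists_min_image (Finset.range (N + 1)) r ⟨0, by simp⟩
    have hjN' : j ≤ N := by simpa [Nat.lt_succ_iff] using hjN
    have hmin (n : ℕ) : r j ≤ r n := by
      rcases le_or_gt n N with hn | hn
      · exact hj n (by simpa [Nat.lt_succ_iff] using hn)
      · obtain ⟨i, hi, hin⟩ := hN n hn
        exact (hj i (by simpa [Nat.lt_succ_iff] using hi)).trans hin
    have : a j ∈ ⋂ n, Metric.closedBall (a n) (r n) := by
      refine Set.mem_iInter.2 fun n => ?_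
      rw [Metric.mem_closedBall]
      rcases le_total n j with hn | hn
      · exact hmem n j hn
      · rw [dist_comm]
        exact (hmem j n hn).trans (hmin n)
    rw [hempty] at this
    exact this
  choose g hg hgr using hescape
  let φ : ℕ → ℕ := fun n => g^[n] 0
  have hφ (n : ℕ) : φ (n + 1) = g (φ n) := Function.iterate_succ_apply' g n 0
  have hφmono : StrictMono φ := strictMono_nat_of_lt_succ fun n => by rw [hφ]; exact hg _
  refine ⟨a ∘ φ, r ∘ φ, fun n => hr _, strictAnti_nat_of_succ_lt fun n => ?_, fun n => ?_,
    fun x => ?_⟩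
  · simp only [Function.comp_apply, hφ]
    exact hgr _ _ le_rfl
  · exact hmem _ _ (hφmono n.lt_succ_self).le
  · by_contra! hx
    have : x ∈ ⋂ n, Metric.closedBall (a n) (r n) := Set.mem_iInter.2 fun n =>
      hanti (hφmono.le_apply : n ≤ φ n) (hx n)
    rw [hempty] at this
    exact this

/-- Scalars have preimages of almost minimal norm under a nonzero functional. -/
theorem ContinuousLinearMap.exists_apply_eq_and_norm_mul_norm_le {k E : Type*}
    [NontriviallyNormedField k] [NormedAddCommGroup E] [NormedSpace k E] (f : E →L[k] k)
    (hf : f ≠ 0) (d : k) (ρ : ℝ) (hd : ‖d‖ < ρ) : ∃ z, f z = d ∧ ‖f‖ * ‖z‖ ≤ ρ := by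
  have hρ : 0 < ρ := (norm_nonneg d).trans_lt hd
  have hfpos : 0 < ‖f‖ := norm_pos_iff.2 hf
  have hlt : ‖d‖ / ρ * ‖f‖ < ‖f‖ := mul_lt_of_lt_one_left hfpos ((div_lt_one hρ).2 hd)
  obtain ⟨u, hu⟩ := f.exists_mul_lt_of_lt_opNorm (by positivity) hlt
  have hfu : 0 < ‖f u‖ := lt_of_le_of_lt (by positivity) hu
  refine ⟨(d / f u) • u, ?_, ?_⟩
  · rw [map_smul, smul_eq_mul, div_mul_cancel₀ _ (norm_pos_iff.1 hfu)]
  · rw [norm_smul, norm_div]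
    have h1 : ‖d‖ * (‖f‖ * ‖u‖) ≤ ρ * ‖f u‖ := by
      have := mul_le_mul_of_nonneg_left hu.le hρ.le
      calc ‖d‖ * (‖f‖ * ‖u‖) = ρ * (‖d‖ / ρ * ‖f‖ * ‖u‖) := by field_simp
        _ ≤ ρ * ‖f u‖ := this
    calc ‖f‖ * (‖d‖ / ‖f u‖ * ‖u‖) = ‖d‖ * (‖f‖ * ‖u‖) / ‖f u‖ := by ring
      _ ≤ ρ := (div_le_iff₀ hfu).2 h1

namespace Ban

variable {k : Type u} [NontriviallyNormedField k]

/-! ### Functionals on `ℓ^∞` that vanish on `C₀` -/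

theorem mem_nullFamilies_iff {I : Type u} {W : I → Ban k} {w : boundedProd W} :
    w ∈ nullFamilies W ↔ ∀ ε : ℝ, 0 < ε → {i | ε ≤ ‖w.1 i‖}.Finite :=
  Iff.rfl

theorem mem_nullFamilies_of_finite_support {I : Type u} {W : I → Ban k} {w : boundedProd W}
    (hw : {i | w.1 i ≠ 0}.Finite) : w ∈ nullFamilies W :=
  mem_nullFamilies_iff.2 fun _ hε => hw.subset fun _ hi =>
    norm_pos_iff.1 (hε.trans_le hi)

/-- The family of `ℓ^∞(ω, V)` whose entries are those of a bounded sequence. -/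
noncomputable def ofBounded {V : Ban k} (v : ℕ → V) (C : ℝ) (hv : ∀ n, ‖v n‖ ≤ C) :
    ellInfty (ULift.{u} ℕ) V :=
  ⟨fun i => v i.down, memℓp_infty ⟨C, by rintro _ ⟨i, rfl⟩; exact hv i.down⟩⟩

theorem norm_ofBounded_le {V : Ban k} (v : ℕ → V) (C : ℝ) (hv : ∀ n, ‖v n‖ ≤ C) :
    ‖ofBounded v C hv‖ ≤ C :=
  lp.norm_le_of_forall_le ((norm_nonneg _).trans (hv 0)) fun i => hv i.down

theorem norm_apply_le {I : Type u} {W : I → Ban k} (w : boundedProd W) (i : I) :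
    ‖w.1 i‖ ≤ ‖w‖ :=
  lp.norm_apply_le_norm (E := fun i => (W i : Type u)) ENNReal.top_ne_zero w i

/-- Over a field that is not spherically complete, a functional on `ℓ^∞(ω, V)` that vanishes
on `C₀(ω, V)` is zero. -/
theorem eq_zero_of_forall_mem_cZero [IsUltrametricDist k] (hk : ¬ IsSphericallyComplete k)
    {V : Ban k} (f : ellInfty (ULift.{u} ℕ) V →L[k] k)
    (hf : ∀ w ∈ cZero (ULift.{u} ℕ) V, f w = 0) : f = 0 := by
  by_contra hf0
  have hfpos : 0 < ‖f‖ := norm_pos_iff.2 hf0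
  obtain ⟨a, r, hr, hanti, hdist, hno⟩ :=
    exists_strictAnti_radii_of_not_isSphericallyComplete hk
  -- The functional need not attain its norm, so lifting needs slack: shifting the index bounds the
  -- increment by `r (n + 1)`, strictly below `r n`.
  choose z hz hzn using fun n => f.exists_apply_eq_and_norm_mul_norm_le hf0
    (a (n + 2) - a (n + 1)) (r n)
    (by rw [← dist_eq_norm]; exact (hdist (n + 1)).trans_lt (hanti n.lt_succ_self))
  obtain ⟨x₀, hx₀, -⟩ := f.exists_apply_eq_and_norm_mul_norm_le hf0 (a 1) (‖a 1‖ + 1)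
    (lt_add_one _)
  let x : ℕ → ellInfty (ULift.{u} ℕ) V := fun n => x₀ + ∑ j ∈ Finset.range n, z j
  have hxsucc (n : ℕ) : x (n + 1) = x n + z n := by
    simp only [x, Finset.sum_range_succ, add_assoc]
  have hfx (n : ℕ) : f (x n) = a (n + 1) := by
    induction n with
    | zero => simpa [x] using hx₀
    | succ n ih => rw [hxsucc, map_add, ih, hz]; ring
  have hxx (n m : ℕ) (hnm : n ≤ m) : ‖x m - x n‖ ≤ r n / ‖f‖ := by
    induction m, hnm using Nat.le_induction with
    | base => simpa using (div_pos (hr n) hfpos).le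
    | succ m hnm ih =>
      rw [hxsucc, add_sub_right_comm]
      refine (IsUltrametricDist.norm_add_le_max _ _).trans (max_le ih ?_)
      rw [le_div_iff₀' hfpos]
      exact (hzn m).trans (hanti.antitone hnm)
  have hcoord (n m : ℕ) (hnm : n ≤ m) (i : ULift.{u} ℕ) :
      ‖(x m).1 i - (x n).1 i‖ ≤ r n / ‖f‖ :=
    (norm_apply_le (x m - x n) i).trans (hxx n m hnm)
  have hxbound (m : ℕ) : ‖(x m).1 ⟨m⟩‖ ≤ r 0 / ‖f‖ + ‖x 0‖ := by
    calc ‖(x m).1 ⟨m⟩‖ ≤ ‖x m‖ := norm_apply_le _ _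
      _ = ‖(x m - x 0) + x 0‖ := by rw [sub_add_cancel]
      _ ≤ ‖x m - x 0‖ + ‖x 0‖ := norm_add_le _ _
      _ ≤ _ := by gcongr; exact hxx 0 m m.zero_le
  -- The diagonal sequence serves as a pseudo-limit of the `x n` modulo `C₀`.
  let y := ofBounded (fun m => (x m).1 ⟨m⟩) _ hxbound
  obtain ⟨n, hn⟩ := hno (f y)
  refine absurd hn (not_lt.2 ?_)
  -- This is `y - x n` with its first `n` entries set to zero: a change by an element of `C₀`,
  -- invisible to `f`, after which the norm is at most `r n / ‖f‖`.
  let t := ofBounded (fun m => if n ≤ m then (x m).1 ⟨m⟩ - (x n).1 ⟨m⟩ else 0) (r n / ‖f‖)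
    (fun m => by
      split_ifs with h
      · exact hcoord n m h _
      · simpa using (div_pos (hr n) hfpos).le)
  have hnull : y - x n - t ∈ cZero (ULift.{u} ℕ) V := by
    refine mem_nullFamilies_of_finite_support
      (((Set.finite_lt_nat n).preimage ULift.down_injective.injOn).subset fun i hi => ?_)
    by_contra hni
    refine hi ?_
    change (x i.down).1 i - (x n).1 i -
      (if n ≤ i.down then (x i.down).1 i - (x n).1 i else 0) = 0
    rw [if_pos (not_lt.1 hni), sub_self]
  have hfy : f y - a (n + 1) = f t := by
    have := hf _ hnull
    rw [map_sub, map_sub, hfx] at this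
    exact sub_eq_zero.1 this
  have hft : ‖f t‖ ≤ r n :=
    calc ‖f t‖ ≤ ‖f‖ * ‖t‖ := f.le_opNorm t
      _ ≤ ‖f‖ * (r n / ‖f‖) := by gcongr; exact norm_ofBounded_le _ _ _
      _ = r n := by field_simp
  refine (dist_triangle_max (f y) (a (n + 1)) (a n)).trans (max_le ?_ (hdist n))
  rwa [dist_eq_norm, hfy]

/-! ### Separation of points by the dual -/

/-- The continuous functionals on a Banach space separate its points. -/
def DualSeparatesPoints (V : Ban k) : Prop :=
  ∀ v : V, (∀ f : V →L[k] k, f v = 0) → v = 0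

/-- The projection of a bounded direct product to a factor. -/
noncomputable def proj {I : Type u} (W : I → Ban k) (i : I) : boundedProd W →L[k] W i :=
  LinearMap.mkContinuous
    { toFun := fun w => w.1 i
      map_add' := fun _ _ => rfl
      map_smul' := fun _ _ => rfl } 1
    fun w => by rw [one_mul]; exact norm_apply_le w i

theorem DualSeparatesPoints.boundedProd {I : Type u} {W : I → Ban k}
    (hW : ∀ i, (W i).DualSeparatesPoints) : (boundedProd W).DualSeparatesPoints :=
  fun w hw => Subtype.ext <| funext fun i => hW i (w.1 i) fun f => hw (f.comp (proj W i))

theorem DualSeparatesPoints.ofClosed {V : Ban k} (hV : V.DualSeparatesPoints)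
    (S : Submodule k V) (hS : IsClosed (S : Set V)) : (V.ofClosed S hS).DualSeparatesPoints :=
  fun w hw => Subtype.ext <| hV w.1 fun f => hw (f.comp S.subtypeL)

theorem DualSeparatesPoints.of_iso {V W : Ban k} (e : V.Iso W) (hV : V.DualSeparatesPoints) :
    W.DualSeparatesPoints := by
  obtain ⟨e⟩ := e
  intro w hw
  have : e.symm w = 0 := hV _ fun f => by
    simpa using hw (f.comp (e.symm.toContinuousLinearEquiv : W →L[k] V))
  simpa using this

theorem Reid.dualSeparatesPoints [CompleteSpace k] [IsUltrametricDist k]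
    {κ : WithTop Cardinal.{u}} {V : Ban k} (hV : Reid k κ V) : V.DualSeparatesPoints := by
  induction hV with
  | ground => exact fun v hv => hv (ContinuousLinearMap.id k k)
  | iso V W e _ ih => exact ih.of_iso e
  | boundedProd I _ W _ ih => exact .boundedProd ih
  | completedSum I _ W _ ih => exact (DualSeparatesPoints.boundedProd ih).ofClosed _ _

theorem IsReflexive.dualSeparatesPoints {V : Ban k} (hV : V.IsReflexive) :
    V.DualSeparatesPoints := fun v hv =>
  hV.1.injective <| by
    rw [map_zero]
    exact ContinuousLinearMap.ext fun f => hv f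

/-- Functionals on the quotient pull back to functionals killing `C₀`, hence are zero, while the
constant sequence `1` has nonzero class. -/
theorem not_dualSeparatesPoints_quotient_cZero [CompleteSpace k] [IsUltrametricDist k]
    (hk : ¬ IsSphericallyComplete k) :
    ¬ ((ellInfty (ULift.{u} ℕ) (ground k)).quotient (cZero (ULift.{u} ℕ) (ground k))
      (isClosed_cZero (ULift.{u} ℕ) (ground k))).DualSeparatesPoints := by
  intro h
  let w : ellInfty (ULift.{u} ℕ) (ground k) :=
    ofBounded (V := ground k) (fun _ => (1 : k)) 1 fun _ => (norm_one (α := k)).le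
  let S := cZero (ULift.{u} ℕ) (ground k)
  have hmk : (Submodule.Quotient.mk w : ellInfty (ULift.{u} ℕ) (ground k) ⧸ S) = 0 := by
    refine h (Submodule.Quotient.mk w) fun f => ?_
    let q : ellInfty (ULift.{u} ℕ) (ground k) →L[k]
        ((ellInfty (ULift.{u} ℕ) (ground k)).quotient S (isClosed_cZero _ _)) :=
      LinearMap.mkContinuous S.mkQ 1 fun v => by
        rw [one_mul]
        exact Submodule.Quotient.norm_mk_le S v
    have hq : f.comp q = 0 := eq_zero_of_forall_mem_cZero hk _ fun v hv => by
      have : q v = 0 := (Submodule.Quotient.mk_eq_zero S).2 hv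
      rw [ContinuousLinearMap.comp_apply, this, map_zero]
    exact DFunLike.congr_fun hq w
  have hw := mem_nullFamilies_iff.1 ((Submodule.Quotient.mk_eq_zero S).1 hmk) 1 one_pos
  exact Set.infinite_univ (hw.subset fun _ _ => (norm_one (α := k)).ge)

end Ban

theorem mainTheorem9 (k : Type u) [NontriviallyNormedField k] [CompleteSpace k]
    [IsUltrametricDist k] (κ : WithTop Cardinal.{u}) (hκ : ((ℵ₀ : Cardinal.{u}) : WithTop Cardinal.{u}) ≤ κ)
    (hκω : κ ≠ ((ℵ₀ : Cardinal.{u}) : WithTop Cardinal.{u}))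
    (hk : ¬ IsSphericallyComplete k) :
    ¬ Ban.ClosedUnderQuotients (Ban.Reid k κ) ∧
    Ban.Reid k κ (Ban.ellInfty (ULift.{u} ℕ) (Ban.ground k)) ∧
    ¬ Ban.IsReflexive ((Ban.ellInfty (ULift.{u} ℕ) (Ban.ground k)).quotient
        (Ban.cZero (ULift.{u} ℕ) (Ban.ground k))
        (Ban.isClosed_cZero (ULift.{u} ℕ) (Ban.ground k))) ∧
    ¬ Ban.Reid k κ ((Ban.ellInfty (ULift.{u} ℕ) (Ban.ground k)).quotient
        (Ban.cZero (ULift.{u} ℕ) (Ban.ground k))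
        (Ban.isClosed_cZero (ULift.{u} ℕ) (Ban.ground k))) := by
  have hω : ((ℵ₀ : Cardinal.{u}) : WithTop Cardinal.{u}) < κ := lt_of_le_of_ne hκ hκω.symm
  have hmem : Ban.Reid k κ (Ban.ellInfty (ULift.{u} ℕ) (Ban.ground k)) :=
    .boundedProd _ (by simpa using hω) _ fun _ => .ground
  have hsep := Ban.not_dualSeparatesPoints_quotient_cZero hk
  exact ⟨fun h => hsep (h _ hmem _ _).dualSeparatesPoints, hmem,
    fun h => hsep h.dualSeparatesPoints, fun h => hsep h.dualSeparatesPoints⟩
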